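/- Let $p$ be an odd prime, let $\overline{\mathbb{Q}_p}$ be an algebraic closure of $\mathbb{Q}_p$, and let $\operatorname{ord}_p$ be the $p$-adic valuation on $\overline{\mathbb{Q}_p}$ normalized by $\operatorname{ord}_p(p)=1$. Let $\zeta_{p^2}\in\overline{\mathbb{Q}_p}$ be any primitive $p^2$-th root of unity, let $\sqrt[p]{p}\in\overline{\mathbb{Q}_p}$ be any $p$-th root of $p$, and put $\pi=\zeta_{p^2}-1$ and $K=\mathbb{Q}_p(\zeta_{p^2},\sqrt[p]{p})$. Then $K/\mathbb{Q}_p$ is totally ramified of degree $p^2(p-1)$, and the element \[ w=\pi^{-2p+3}\left(\sqrt[p]{p}+\pi^{p-1}+\sum_{t=1}^{p-2}\frac{(-1)^t}{t+1}\sqrt[p]{p}\,\pi^{t}\right) \] is a uniformizer of $K$, that is, $w$ lies in the ring of integers of $K$ (the integral closure of $\mathbb{Z}_p$ in $K$), which is a discrete valuation ring, and generates its maximal ideal. Moreover $w\neq 0$ and \[ \operatorname{ord}_p(w)=\frac{1}{p^2(p-1)}=\frac{1}{[K:\mathbb{Q}_p]}. \] -/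

import Mathlib

open scoped IntermediateField

noncomputable section

namespace PadicUniformizer

variable {p : ℕ} [Fact p.Prime]

/-- The `p`-adic valuation on the algebraic closure of `ℚ_[p]`, normalized so that `p` has
valuation `1`: the `p`-adic norm satisfies `‖x‖ = p ^ (-ordP x)` for nonzero `x`. (It is only
meaningful for nonzero `x`; the convention here is `ordP 0 = 0`.) -/
def ordP (x : PadicAlgCl p) : ℝ := -Real.logb p ‖x‖

/-- The ring of integers of an extension `K` of `ℚ_[p]`: the elements integral over `ℤ_[p]`. -/
abbrev integers (K : IntermediateField ℚ_[p] (PadicAlgCl p)) : Subalgebra ℤ_[p] K :=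
  integralClosure ℤ_[p] K

/-- `x` is a uniformizer of `K`: the ring of integers of `K` is a discrete valuation ring, and `x`
is an element of it that generates its maximal ideal. -/
def IsUniformizer (K : IntermediateField ℚ_[p] (PadicAlgCl p)) (x : PadicAlgCl p) : Prop :=
  ∃ _ : IsDiscreteValuationRing (integers K), ∃ w : integers K,
    ((w : K) : PadicAlgCl p) = x ∧ IsLocalRing.maximalIdeal (integers K) = Ideal.span {w}

/-- `K / ℚ_[p]` is totally ramified: it is finite, and the ramification index over `ℤ_[p]` of the
maximal ideal of the ring of integers of `K` is the degree of the extension. -/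
def IsTotallyRamified (K : IntermediateField ℚ_[p] (PadicAlgCl p)) : Prop :=
  FiniteDimensional ℚ_[p] K ∧
    ∀ P : Ideal (integers K), P.IsMaximal →
      P.ramificationIdx ℤ_[p] = Module.finrank ℚ_[p] K

/-- The element
`π ^ (-2p+3) * (α + π ^ (p-1) + ∑_{t=1}^{p-2} ((-1) ^ t / (t+1)) * α * π ^ t)`, `π = ζ - 1`,
where `ζ` is to be a primitive `p ^ 2`-th root of unity and `α` a `p`-th root of `p`. -/
def unif (ζ α : PadicAlgCl p) : PadicAlgCl p :=
  (ζ - 1) ^ (-2 * (p : ℤ) + 3) *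
    (α + (ζ - 1) ^ (p - 1) +
      ∑ t ∈ Finset.Icc 1 (p - 2),
        ((-1 : PadicAlgCl p) ^ t / ((t : PadicAlgCl p) + 1)) * α * (ζ - 1) ^ t)

end PadicUniformizer

end

namespace PadicUniformizer

/-! Everything reduces to the equality `‖w‖ ^ N = ‖p‖` with `N = p ^ 2 * (p - 1)`, plus the easy
bound `[K : ℚ_p] ≤ N`. Write `T` for `truncLog p`, `α` for the root of `p`, `η = ζ ^ p`, `B = α T(π)
+ π ^ (p - 1)`. Modulo `p ^ 2`, `B ^ p ≡ p T(π) ^ p + π ^ (p (p - 1)) ≡ p T(η - 1) + π ^ (p (p - 1))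
≡ π ^ (p (p - 1)) - (η - 1) ^ (p - 1)`: `T` commutes with `p`-th powers modulo `p`, `π ^ p ≡ η - 1`,
and `(η - 1) ^ (p - 1) ≡ -p T(η - 1)` because `η ^ p = 1`. Since `η - 1 - π ^ p` has absolute value
exactly `‖p‖ ‖π‖`, the last difference has absolute value `‖π‖ ^ ((2p - 1) (p - 1))`, larger than
`‖p‖ ^ 2`, so it determines `‖B‖ ^ p` (`norm_numerator_pow`). The factor `π ^ (-2p + 3)` leaves `‖w‖
^ p = ‖π‖`. The powers `w ^ i`, `i < N`, then have absolute values in distinct classes modulo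
`‖ℚ_pˣ‖`. They are therefore a basis of `K`, and the value group of `K` is generated by `‖w‖`
(`exists_norm_sum_eq_zpow`). The remaining claims follow. -/

theorem choose_pred_prime_modEq {q : ℕ} (hq : q.Prime) {j : ℕ} (hj : j < q) :
    ((q - 1).choose j : ℤ) ≡ (-1) ^ j [ZMOD q] := by
  induction j with
  | zero => simp
  | succ j ih =>
    have h1 : ((q - 1).choose j : ℤ) + (q - 1).choose (j + 1) ≡ 0 [ZMOD q] := by
      rw [Int.modEq_zero_iff_dvd]
      have h2 := hq.dvd_choose_self (Nat.succ_ne_zero j) hj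
      obtain ⟨n, rfl⟩ : ∃ n, q = n + 1 := ⟨q - 1, by omega⟩
      rw [Nat.choose_succ_succ] at h2
      exact_mod_cast h2
    have h3 := h1.sub (ih (by omega))
    rw [pow_succ]
    simpa using h3

/-! ### Ultrametric estimates and Frobenius modulo `p` -/

section Ultrametric

variable {L : Type*} [NormedField L] [IsUltrametricDist L]

theorem norm_sub_le_of_norm_sub_le {x y z : L} {c : ℝ} (h₁ : ‖x - y‖ ≤ c) (h₂ : ‖y - z‖ ≤ c) :
    ‖x - z‖ ≤ c := by
  rw [← sub_add_sub_cancel x y z]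
  exact (IsUltrametricDist.norm_add_le_max _ _).trans (max_le h₁ h₂)

theorem norm_add_le_of_le {x y : L} {c : ℝ} (hx : ‖x‖ ≤ c) (hy : ‖y‖ ≤ c) : ‖x + y‖ ≤ c :=
  (IsUltrametricDist.norm_add_le_max _ _).trans (max_le hx hy)

theorem norm_eq_of_norm_sub_lt {x y : L} (h : ‖x - y‖ < ‖y‖) : ‖x‖ = ‖y‖ := by
  have := IsUltrametricDist.norm_add_eq_max_of_norm_ne_norm (x := x - y) (y := y) h.ne
  rwa [sub_add_cancel, max_eq_right h.le] at this

theorem norm_pow_sub_pow_le {x y : L} (hx : ‖x‖ ≤ 1) (hy : ‖y‖ ≤ 1) (n : ℕ) :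
    ‖x ^ n - y ^ n‖ ≤ ‖x - y‖ := by
  rw [← geom_sum₂_mul, norm_mul]
  refine mul_le_of_le_one_left (norm_nonneg _) ?_
  refine IsUltrametricDist.norm_sum_le_of_forall_le_of_nonneg zero_le_one fun i _ => ?_
  rw [norm_mul, norm_pow, norm_pow]
  exact mul_le_one₀ (pow_le_one₀ (norm_nonneg x) hx) (by positivity)
    (pow_le_one₀ (norm_nonneg y) hy)

variable {p : ℕ} [Fact p.Prime]

theorem norm_add_pow_prime_sub_le {x y : L} (hx : ‖x‖ ≤ 1) (hy : ‖y‖ ≤ 1) :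
    ‖(x + y) ^ p - (x ^ p + y ^ p)‖ ≤ ‖(p : L)‖ := by
  rw [add_pow_prime_eq Fact.out, add_sub_cancel_left, mul_assoc, mul_assoc, norm_mul]
  refine mul_le_of_le_one_right (norm_nonneg _) ?_
  rw [norm_mul, norm_mul]
  refine mul_le_one₀ hx (by positivity) (mul_le_one₀ hy (by positivity) ?_)
  refine IsUltrametricDist.norm_sum_le_of_forall_le_of_nonneg zero_le_one fun i _ => ?_
  rw [norm_mul, norm_mul, norm_pow, norm_pow]
  exact mul_le_one₀ (mul_le_one₀ (pow_le_one₀ (norm_nonneg x) hx) (by positivity)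
    (pow_le_one₀ (norm_nonneg y) hy)) (by positivity) (IsUltrametricDist.norm_natCast_le_one L _)

theorem norm_sum_pow_prime_sub_le {ι : Type*} (s : Finset ι) (f : ι → L)
    (hf : ∀ i ∈ s, ‖f i‖ ≤ 1) : ‖(∑ i ∈ s, f i) ^ p - ∑ i ∈ s, f i ^ p‖ ≤ ‖(p : L)‖ := by
  classical
  induction s using Finset.induction_on with
  | empty => simp [(Fact.out : p.Prime).ne_zero]
  | insert a s ha ih =>
    rw [Finset.sum_insert ha, Finset.sum_insert ha]
    have hs : ∀ i ∈ s, ‖f i‖ ≤ 1 := fun i hi => hf i (Finset.mem_insert_of_mem hi)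
    refine norm_sub_le_of_norm_sub_le (norm_add_pow_prime_sub_le
      (hf a (Finset.mem_insert_self a s))
      (IsUltrametricDist.norm_sum_le_of_forall_le_of_nonneg zero_le_one hs)) ?_
    rw [add_sub_add_left_eq_sub]
    exact ih hs

end Ultrametric

/-! ### Congruences for the truncated logarithm -/

section Congruences

variable {p : ℕ} [Fact p.Prime] {L : Type*} [NormedField L] [NormedAlgebra ℚ_[p] L]

/-- The truncation at degree `p - 2` of the power series `log (1 + x) / x`. -/
def truncLog (p : ℕ) {L : Type*} [Field L] (x : L) : L :=
  ∑ t ∈ Finset.range (p - 1), (-1 : L) ^ t / ((t : L) + 1) * x ^ t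

variable (p) in
theorem norm_prime (L : Type*) [NormedField L] [NormedAlgebra ℚ_[p] L] :
    ‖(p : L)‖ = (p : ℝ)⁻¹ := by
  rw [← map_natCast (algebraMap ℚ_[p] L), norm_algebraMap', Padic.norm_p]

variable (p) in
theorem norm_natCast_eq_one (L : Type*) [NormedField L] [NormedAlgebra ℚ_[p] L] {k : ℕ}
    (h0 : 0 < k) (hk : k < p) : ‖(k : L)‖ = 1 := by
  rw [← map_natCast (algebraMap ℚ_[p] L), norm_algebraMap', Padic.norm_natCast_eq_one_iff]
  exact Nat.coprime_of_lt_prime h0.ne' hk Fact.out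

theorem norm_prime_pos (L : Type*) [NormedField L] [NormedAlgebra ℚ_[p] L] : 0 < ‖(p : L)‖ := by
  rw [norm_prime]
  exact inv_pos.2 (Nat.cast_pos.2 (Fact.out : p.Prime).pos)

theorem norm_prime_lt_one (L : Type*) [NormedField L] [NormedAlgebra ℚ_[p] L] :
    ‖(p : L)‖ < 1 := by
  rw [norm_prime]
  exact inv_lt_one_of_one_lt₀ (Nat.one_lt_cast.2 (Fact.out : p.Prime).one_lt)

theorem norm_truncLog_coeff {t : ℕ} (ht : t ∈ Finset.range (p - 1)) :
    ‖(-1 : L) ^ t / ((t : L) + 1)‖ = 1 := by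
  have h := norm_natCast_eq_one p L (k := t + 1) (by omega) (by simp at ht; omega)
  push_cast at h
  rw [norm_div, h, norm_pow, norm_neg, norm_one, one_pow, div_one]

variable [IsUltrametricDist L]

/-- From `(t + 1) * p.choose (t + 1) = p * (p - 1).choose t` and `(p - 1).choose t ≡ (-1) ^ t`
modulo `p`, with `t + 1` a unit. -/
theorem norm_choose_prime_sub_le {t : ℕ} (ht : t ∈ Finset.range (p - 1)) :
    ‖((p.choose (t + 1) : ℕ) : L) - p * ((-1) ^ t / ((t : L) + 1))‖ ≤ ‖(p : L)‖ ^ 2 := by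
  have ht' : t + 1 < p := by simp at ht; omega
  have h1 := norm_natCast_eq_one p L (k := t + 1) (by omega) ht'
  push_cast at h1
  have h0 : (t : L) + 1 ≠ 0 := fun h => by simp [h] at h1
  obtain ⟨m, hm⟩ := (choose_pred_prime_modEq (Fact.out : p.Prime) (by omega : t < p)).symm.dvd
  have h2 : (p.choose (t + 1) : L) * (t + 1) = p * ((p - 1).choose t : ℕ) := by
    have := Nat.add_one_mul_choose_eq (p - 1) t
    rw [Nat.sub_add_cancel (Fact.out : p.Prime).one_le] at this
    exact_mod_cast congrArg (Nat.cast : ℕ → L) this.symm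
  have h3 : (((p - 1).choose t : ℕ) : L) - (-1) ^ t = p * m := by
    have := congrArg (Int.cast : ℤ → L) hm
    push_cast at this
    exact this
  have h4 : ((p.choose (t + 1) : ℕ) : L) - p * ((-1) ^ t / ((t : L) + 1))
      = p ^ 2 * m / (t + 1) := by
    field_simp
    linear_combination h2 + p * h3
  rw [h4, norm_div, h1, norm_mul, norm_pow, div_one]
  exact mul_le_of_le_one_right (by positivity) (IsUltrametricDist.norm_intCast_le_one L m)

/-- The middle binomial coefficients are replaced by their values modulo `p ^ 2`. The factor `‖x‖`
in the error allows a later division by `x`. -/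
theorem norm_one_add_pow_sub_le {x : L} (hx : ‖x‖ ≤ 1) :
    ‖(1 + x) ^ p - 1 - x ^ p - p * x * truncLog p x‖ ≤ ‖(p : L)‖ ^ 2 * ‖x‖ := by
  have key : (1 + x) ^ p - 1 - x ^ p - p * x * truncLog p x =
      ∑ t ∈ Finset.range (p - 1),
        (((p.choose (t + 1) : ℕ) : L) - p * ((-1) ^ t / ((t : L) + 1))) * x ^ (t + 1) := by
    have h : (1 + x) ^ p = x ^ p + 1 +
        ∑ t ∈ Finset.range (p - 1), ((p.choose (t + 1) : ℕ) : L) * x ^ (t + 1) := by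
      obtain ⟨n, hn⟩ : ∃ n, p = n + 1 := ⟨p - 1, by have := (Fact.out : p.Prime).pos; omega⟩
      rw [add_comm 1 x, add_pow, hn, Finset.sum_range_succ, Finset.sum_range_succ']
      simp [mul_comm]
      ring
    simp_rw [h, truncLog, sub_mul, Finset.sum_sub_distrib, Finset.mul_sum]
    have : ∑ t ∈ Finset.range (p - 1), (p : L) * x * ((-1) ^ t / ((t : L) + 1) * x ^ t) =
        ∑ t ∈ Finset.range (p - 1), (p : L) * ((-1) ^ t / ((t : L) + 1)) * x ^ (t + 1) :=
      Finset.sum_congr rfl fun t _ => by ring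
    rw [this]
    ring
  rw [key]
  refine IsUltrametricDist.norm_sum_le_of_forall_le_of_nonneg (by positivity) fun t ht => ?_
  rw [norm_mul, norm_pow, pow_succ]
  refine mul_le_mul (norm_choose_prime_sub_le ht) ?_ (by positivity) (by positivity)
  exact mul_le_of_le_one_left (norm_nonneg x) (pow_le_one₀ (norm_nonneg x) hx)

theorem norm_truncLog_sub_le {x y : L} (hx : ‖x‖ ≤ 1) (hy : ‖y‖ ≤ 1) :
    ‖truncLog p x - truncLog p y‖ ≤ ‖x - y‖ := by
  rw [truncLog, truncLog, ← Finset.sum_sub_distrib]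
  refine IsUltrametricDist.norm_sum_le_of_forall_le_of_nonneg (norm_nonneg _) fun t ht => ?_
  rw [← mul_sub, norm_mul, norm_truncLog_coeff ht, one_mul]
  exact norm_pow_sub_pow_le hx hy t

theorem norm_truncLog_le {x : L} (hx : ‖x‖ ≤ 1) : ‖truncLog p x‖ ≤ 1 := by
  refine IsUltrametricDist.norm_sum_le_of_forall_le_of_nonneg zero_le_one fun t ht => ?_
  rw [norm_mul, norm_truncLog_coeff ht, one_mul, norm_pow]
  exact pow_le_one₀ (norm_nonneg x) hx

theorem norm_truncLog {x : L} (hx : ‖x‖ < 1) : ‖truncLog p x‖ = 1 := by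
  have h0 : truncLog p (0 : L) = 1 := by
    rw [truncLog, Finset.sum_eq_single_of_mem 0]
    · simp
    · have := (Fact.out : p.Prime).two_le
      simp only [Finset.mem_range]; omega
    · intro t _ ht
      simp [ht]
  have h := norm_truncLog_sub_le (p := p) hx.le (y := 0) (by simp)
  rw [h0, sub_zero] at h
  rw [← norm_one (α := L)]
  exact norm_eq_of_norm_sub_lt (by rw [norm_one]; exact h.trans_lt hx)

/-- Fermat's little theorem for `t + 1`; oddness of `p` preserves the sign `(-1) ^ t`. -/
theorem norm_truncLog_coeff_pow_sub_le (hp : Odd p) {t : ℕ} (ht : t ∈ Finset.range (p - 1)) :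
    ‖((-1 : L) ^ t / ((t : L) + 1)) ^ p - (-1 : L) ^ t / ((t : L) + 1)‖ ≤ ‖(p : L)‖ := by
  have h1 := norm_natCast_eq_one p L (k := t + 1) (by omega) (by simp at ht; omega)
  push_cast at h1
  have h0 : (t : L) + 1 ≠ 0 := fun h => by simp [h] at h1
  obtain ⟨m, hm⟩ : ((p : ℤ)) ∣ ((t : ℤ) + 1) - ((t : ℤ) + 1) ^ p := by
    rw [← ZMod.intCast_zmod_eq_zero_iff_dvd _ p]
    push_cast
    rw [ZMod.pow_card, sub_self]
  have h2 : ((t : L) + 1) - ((t : L) + 1) ^ p = p * m := by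
    have := congrArg (Int.cast : ℤ → L) hm
    push_cast at this
    exact this
  have h3 : ((-1 : L) ^ t) ^ p = (-1) ^ t := by rw [← pow_mul, mul_comm, pow_mul, hp.neg_one_pow]
  have h4 : ((-1 : L) ^ t / ((t : L) + 1)) ^ p - (-1 : L) ^ t / ((t : L) + 1) =
      (-1) ^ t * (p * m) / ((t + 1) ^ p * (t + 1)) := by
    rw [div_pow, h3, ← h2]
    field_simp
  rw [h4, norm_div, norm_mul, norm_mul, norm_mul, norm_pow, norm_pow, h1]
  simp only [norm_neg, norm_one, one_pow, one_mul, mul_one, div_one]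
  exact mul_le_of_le_one_right (norm_nonneg _) (IsUltrametricDist.norm_intCast_le_one L m)

theorem norm_truncLog_pow_sub_le (hp : Odd p) {x : L} (hx : ‖x‖ ≤ 1) :
    ‖truncLog p x ^ p - truncLog p (x ^ p)‖ ≤ ‖(p : L)‖ := by
  refine norm_sub_le_of_norm_sub_le (norm_sum_pow_prime_sub_le _ _ fun t ht => ?_) ?_
  · rw [norm_mul, norm_truncLog_coeff ht, one_mul, norm_pow]
    exact pow_le_one₀ (norm_nonneg x) hx
  · rw [truncLog, ← Finset.sum_sub_distrib]
    refine IsUltrametricDist.norm_sum_le_of_forall_le_of_nonneg (norm_nonneg _) fun t ht => ?_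
    rw [mul_pow, ← pow_mul, ← pow_mul, mul_comm t p, ← sub_mul, norm_mul, norm_pow]
    exact (mul_le_of_le_one_right (norm_nonneg _) (pow_le_one₀ (norm_nonneg x) hx)).trans
      (norm_truncLog_coeff_pow_sub_le hp ht)

end Congruences

/-! ### Absolute values of `ζ - 1`, `ζ ^ p - 1` and the numerator -/

section Norms

variable {p : ℕ} [Fact p.Prime] {L : Type*} [NormedField L] [NormedAlgebra ℚ_[p] L]
  [IsUltrametricDist L]

theorem norm_sub_one_le_of_pow_eq_one {ζ : L} {n : ℕ} (hn : n ≠ 0) (hζ : ζ ^ n = 1) :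
    ‖ζ - 1‖ ≤ 1 := by
  have h : ‖ζ‖ = 1 := by
    rw [← pow_eq_one_iff_of_nonneg (norm_nonneg ζ) hn, ← norm_pow, hζ, norm_one]
  rw [sub_eq_add_neg]
  exact norm_add_le_of_le h.le (by simp)

/-- Expand `(1 + (η - 1)) ^ p = 1` and divide by `η - 1`. -/
theorem norm_pow_add_truncLog_le {η : L} (hη : IsPrimitiveRoot η p) :
    ‖(η - 1) ^ (p - 1) + p * truncLog p (η - 1)‖ ≤ ‖(p : L)‖ ^ 2 := by
  have hp := (Fact.out : p.Prime)
  have h := norm_one_add_pow_sub_le (p := p)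
    (norm_sub_one_le_of_pow_eq_one hp.ne_zero hη.pow_eq_one)
  have h0 : η - 1 ≠ 0 := sub_ne_zero.2 (hη.ne_one hp.one_lt)
  have h1 : (1 + (η - 1)) ^ p - 1 - (η - 1) ^ p - p * (η - 1) * truncLog p (η - 1)
      = -(((η - 1) ^ (p - 1) + p * truncLog p (η - 1)) * (η - 1)) := by
    rw [add_sub_cancel, hη.pow_eq_one, add_mul, pow_sub_one_mul hp.ne_zero]
    ring
  rw [h1, norm_neg, norm_mul] at h
  exact le_of_mul_le_mul_right h (norm_pos_iff.2 h0)

theorem norm_sub_one_pow_of_isPrimitiveRoot {η : L} (hη : IsPrimitiveRoot η p) :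
    ‖η - 1‖ ^ (p - 1) = ‖(p : L)‖ := by
  have hp := (Fact.out : p.Prime)
  have hq0 := norm_prime_pos (p := p) L
  have hq1 := norm_prime_lt_one (p := p) L
  have hsq : ‖(p : L)‖ ^ 2 < ‖(p : L)‖ := pow_lt_self_of_lt_one₀ hq0 hq1 one_lt_two
  have h := norm_pow_add_truncLog_le hη
  rw [← sub_neg_eq_add] at h
  have hle := norm_sub_one_le_of_pow_eq_one hp.ne_zero hη.pow_eq_one
  have h1 : ‖(η - 1) ^ (p - 1)‖ ≤ ‖(p : L)‖ := by
    rw [← sub_add_cancel ((η - 1) ^ (p - 1)) (-(p * truncLog p (η - 1)))]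
    refine norm_add_le_of_le (h.trans hsq.le) ?_
    rw [norm_neg, norm_mul]
    exact mul_le_of_le_one_right hq0.le (norm_truncLog_le hle)
  -- The crude bound `h1` already excludes `‖η - 1‖ = 1`; then the truncated logarithm is a unit and
  -- the estimate becomes an equality.
  have hlt : ‖η - 1‖ < 1 := by
    refine lt_of_le_of_ne hle fun h2 => ?_
    rw [norm_pow, h2, one_pow] at h1
    exact h1.not_gt hq1
  have h3 : ‖-(p * truncLog p (η - 1))‖ = ‖(p : L)‖ := by
    rw [norm_neg, norm_mul, norm_truncLog hlt, mul_one]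
  rw [← norm_pow, ← h3]
  exact norm_eq_of_norm_sub_lt (by rw [h3]; exact h.trans_lt hsq)

theorem norm_pow_sub_one_sub_le {ζ : L} (hζ : IsPrimitiveRoot ζ (p ^ 2)) :
    ‖(ζ ^ p - 1) - (ζ - 1) ^ p - p * (ζ - 1) * truncLog p (ζ - 1)‖ ≤
      ‖(p : L)‖ ^ 2 * ‖ζ - 1‖ := by
  have h := norm_one_add_pow_sub_le (p := p) (norm_sub_one_le_of_pow_eq_one
    (pow_ne_zero 2 (Fact.out : p.Prime).ne_zero) hζ.pow_eq_one)
  rwa [add_sub_cancel] at h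

theorem norm_sub_one_pow_of_isPrimitiveRoot_sq (hp : Odd p) {ζ : L}
    (hζ : IsPrimitiveRoot ζ (p ^ 2)) : ‖ζ - 1‖ ^ p = ‖ζ ^ p - 1‖ := by
  have hpp := (Fact.out : p.Prime)
  have hq0 := norm_prime_pos (p := p) L
  have hq1 := norm_prime_lt_one (p := p) L
  have hη : IsPrimitiveRoot (ζ ^ p) p := hζ.pow (pow_pos hpp.pos 2) (sq p)
  have hle := norm_sub_one_le_of_pow_eq_one (pow_ne_zero 2 hpp.ne_zero) hζ.pow_eq_one
  have h := norm_sub_one_pow_of_isPrimitiveRoot hη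
  -- Uses `p - 1 ≥ 2`: as `‖ζ ^ p - 1‖ ^ (p - 1) = ‖p‖`, the element `ζ ^ p - 1` dominates an error
  -- of size `‖p‖`.
  have hlt : ‖(p : L)‖ < ‖ζ ^ p - 1‖ := by
    by_contra! hcon
    have h1 : ‖ζ ^ p - 1‖ ^ (p - 1) ≤ ‖(p : L)‖ ^ (p - 1) :=
      pow_le_pow_left₀ (norm_nonneg _) hcon _
    have h2 : ‖(p : L)‖ ^ (p - 1) < ‖(p : L)‖ := pow_lt_self_of_lt_one₀ hq0 hq1 (by
      have := hpp.two_le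
      rcases hp with ⟨k, hk⟩
      omega)
    linarith
  have h1 : ‖(ζ ^ p - 1) - (ζ - 1) ^ p‖ ≤ ‖(p : L)‖ := by
    rw [← sub_add_cancel ((ζ ^ p - 1) - (ζ - 1) ^ p) (p * (ζ - 1) * truncLog p (ζ - 1))]
    refine norm_add_le_of_le ((norm_pow_sub_one_sub_le hζ).trans ?_) ?_
    · exact (mul_le_of_le_one_right (by positivity) hle).trans
        (pow_le_of_le_one hq0.le hq1.le two_ne_zero)
    · rw [mul_assoc, norm_mul, norm_mul]
      exact mul_le_of_le_one_right hq0.le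
        (mul_le_one₀ hle (norm_nonneg _) (norm_truncLog_le hle))
  rw [← norm_pow]
  exact norm_eq_of_norm_sub_lt (by rw [norm_sub_rev]; exact h1.trans_lt hlt)

theorem norm_sub_one_pow_eq_norm_prime (hp : Odd p) {ζ : L} (hζ : IsPrimitiveRoot ζ (p ^ 2)) :
    ‖ζ - 1‖ ^ (p * (p - 1)) = ‖(p : L)‖ := by
  rw [pow_mul, norm_sub_one_pow_of_isPrimitiveRoot_sq hp hζ]
  exact norm_sub_one_pow_of_isPrimitiveRoot
    (hζ.pow (pow_pos (Fact.out : p.Prime).pos 2) (sq p))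

theorem norm_sub_one_lt_one (hp : Odd p) {ζ : L} (hζ : IsPrimitiveRoot ζ (p ^ 2)) :
    ‖ζ - 1‖ < 1 := by
  by_contra! h
  have h1 := one_le_pow₀ h (n := p * (p - 1))
  rw [norm_sub_one_pow_eq_norm_prime hp hζ] at h1
  exact h1.not_gt (norm_prime_lt_one L)

theorem norm_pow_sub_one_sub (hp : Odd p) {ζ : L} (hζ : IsPrimitiveRoot ζ (p ^ 2)) :
    ‖(ζ ^ p - 1) - (ζ - 1) ^ p‖ = ‖(p : L)‖ * ‖ζ - 1‖ := by
  have hpp := (Fact.out : p.Prime)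
  have hq0 := norm_prime_pos (p := p) L
  have hr : 0 < ‖ζ - 1‖ := norm_pos_iff.2
    (sub_ne_zero.2 (hζ.ne_one (Nat.one_lt_pow two_ne_zero hpp.one_lt)))
  have h : ‖p * (ζ - 1) * truncLog p (ζ - 1)‖ = ‖(p : L)‖ * ‖ζ - 1‖ := by
    rw [norm_mul, norm_mul, norm_truncLog (norm_sub_one_lt_one hp hζ), mul_one]
  rw [← h]
  refine norm_eq_of_norm_sub_lt ((norm_pow_sub_one_sub_le hζ).trans_lt ?_)
  rw [h]
  exact mul_lt_mul_of_pos_right (pow_lt_self_of_lt_one₀ hq0 (norm_prime_lt_one L) one_lt_two) hr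

/-- If `x` is close to `y`, then `x ^ (p - 1)` is exactly as close to `y ^ (p - 1)` as first-order
approximation predicts. -/
theorem norm_pow_pred_prime_sub {x y : L} (h : ‖x - y‖ < ‖y‖) :
    ‖x ^ (p - 1) - y ^ (p - 1)‖ = ‖x - y‖ * ‖y‖ ^ (p - 2) := by
  have hpp := (Fact.out : p.Prime)
  have hy : y ≠ 0 := norm_pos_iff.1 ((norm_nonneg _).trans_lt h)
  have hxy := norm_eq_of_norm_sub_lt h
  have hn : ‖((p - 1 : ℕ) : L)‖ = 1 :=
    norm_natCast_eq_one p L (by have := hpp.two_le; omega) (by have := hpp.two_le; omega)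
  rw [← geom_sum₂_mul, norm_mul, mul_comm]
  congr 1
  have hsum : ∑ i ∈ Finset.range (p - 1), x ^ i * y ^ (p - 1 - 1 - i) =
      y ^ (p - 2) * ∑ i ∈ Finset.range (p - 1), (x / y) ^ i := by
    rw [Finset.mul_sum]
    refine Finset.sum_congr rfl fun i hi => ?_
    have : p - 2 = (p - 1 - 1 - i) + i := by simp at hi; omega
    rw [this, pow_add, div_pow]
    field_simp
  rw [hsum, norm_mul, norm_pow]
  refine mul_eq_left₀ (pow_ne_zero _ (norm_ne_zero_iff.2 hy)) |>.2 ?_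
  rw [← hn]
  refine norm_eq_of_norm_sub_lt ?_
  rw [hn]
  -- As `x / y` is close to `1`, the geometric sum is close to `p - 1`, which is a unit.
  have hz : ‖x / y - 1‖ < 1 := by
    rw [div_sub_one hy, norm_div, div_lt_one (norm_pos_iff.2 hy)]
    exact h
  refine lt_of_le_of_lt ?_ hz
  have : ∑ i ∈ Finset.range (p - 1), (x / y) ^ i - ((p - 1 : ℕ) : L) =
      ∑ i ∈ Finset.range (p - 1), ((x / y) ^ i - 1 ^ i) := by
    simp
  rw [this]
  refine IsUltrametricDist.norm_sum_le_of_forall_le_of_nonneg (norm_nonneg _) fun i _ => ?_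
  refine norm_pow_sub_pow_le ?_ (by simp) i
  rw [norm_div, hxy, div_self (norm_ne_zero_iff.2 hy)]

/-- The absolute value of the second factor of `unif ζ α`. -/
theorem norm_numerator_pow (hp : Odd p) {ζ α : L} (hζ : IsPrimitiveRoot ζ (p ^ 2))
    (hα : α ^ p = p) :
    ‖α * truncLog p (ζ - 1) + (ζ - 1) ^ (p - 1)‖ ^ p =
      ‖ζ - 1‖ ^ ((2 * p - 1) * (p - 1)) := by
  have hpp := (Fact.out : p.Prime)
  have hp3 : 3 ≤ p := by
    have := hpp.two_le
    rcases hp with ⟨k, hk⟩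
    omega
  set π := ζ - 1 with hπ
  set B := α * truncLog p π + π ^ (p - 1) with hB
  have hq0 := norm_prime_pos (p := p) L
  have hq1 := norm_prime_lt_one (p := p) L
  have hπ0 : π ≠ 0 := sub_ne_zero.2 (hζ.ne_one (Nat.one_lt_pow two_ne_zero hpp.one_lt))
  have hr0 : 0 < ‖π‖ := norm_pos_iff.2 hπ0
  have hr1 : ‖π‖ < 1 := norm_sub_one_lt_one hp hζ
  have hq : ‖π‖ ^ (p * (p - 1)) = ‖(p : L)‖ := norm_sub_one_pow_eq_norm_prime hp hζ
  have hαn : ‖α‖ = ‖π‖ ^ (p - 1) := by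
    rw [← pow_left_inj₀ (norm_nonneg α) (by positivity) hpp.ne_zero, ← norm_pow, hα, ← hq,
      ← pow_mul, mul_comm]
  have hd : ‖(ζ ^ p - 1) - π ^ p‖ = ‖(p : L)‖ * ‖π‖ := norm_pow_sub_one_sub hp hζ
  have hη : IsPrimitiveRoot (ζ ^ p) p := hζ.pow (pow_pos hpp.pos 2) (sq p)
  have hηle := norm_sub_one_le_of_pow_eq_one hpp.ne_zero hη.pow_eq_one
  have hπple : ‖π ^ p‖ ≤ 1 := by
    rw [norm_pow]
    exact pow_le_one₀ hr0.le hr1.le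
  -- Both summands of `B` have absolute value `‖π‖ ^ (p - 1)`. Pulling out `π ^ (p - 1)` gains a
  -- factor `‖p‖` after the `p`-th power, improving the error from `‖p‖` to `‖p‖ ^ 2`.
  have h1 : ‖B ^ p - (p * truncLog p π ^ p + π ^ (p * (p - 1)))‖ ≤ ‖(p : L)‖ ^ 2 := by
    have hB' : B = π ^ (p - 1) * (α * truncLog p π / π ^ (p - 1) + 1) := by
      rw [hB]
      field_simp
    have h := norm_add_pow_prime_sub_le (p := p) (x := α * truncLog p π / π ^ (p - 1)) (y := 1)
      (by
        rw [norm_div, norm_mul, hαn, norm_truncLog hr1, norm_pow, mul_one,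
          div_self (pow_ne_zero _ hr0.ne')])
      (by simp)
    have heq : B ^ p - (p * truncLog p π ^ p + π ^ (p * (p - 1))) = π ^ (p * (p - 1)) *
        ((α * truncLog p π / π ^ (p - 1) + 1) ^ p -
          ((α * truncLog p π / π ^ (p - 1)) ^ p + 1 ^ p)) := by
      rw [hB', mul_pow, ← pow_mul, mul_comm (p - 1) p, div_pow, mul_pow, hα, ← pow_mul,
        mul_comm (p - 1) p]
      field_simp
      ring
    rw [heq, norm_mul, norm_pow, hq, sq]
    exact mul_le_mul_of_nonneg_left h hq0.le
  have h2 : ‖(p * truncLog p π ^ p + π ^ (p * (p - 1))) -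
      (p * truncLog p (π ^ p) + π ^ (p * (p - 1)))‖ ≤ ‖(p : L)‖ ^ 2 := by
    rw [add_sub_add_right_eq_sub, ← mul_sub, norm_mul, sq]
    exact mul_le_mul_of_nonneg_left (norm_truncLog_pow_sub_le hp hr1.le) hq0.le
  have h3 : ‖(p * truncLog p (π ^ p) + π ^ (p * (p - 1))) -
      (p * truncLog p (ζ ^ p - 1) + π ^ (p * (p - 1)))‖ ≤ ‖(p : L)‖ ^ 2 := by
    rw [add_sub_add_right_eq_sub, ← mul_sub, norm_mul, sq]
    refine mul_le_mul_of_nonneg_left ((norm_truncLog_sub_le hπple hηle).trans ?_) hq0.le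
    rw [norm_sub_rev, hd]
    exact mul_le_of_le_one_right hq0.le hr1.le
  have h4 : ‖(p * truncLog p (ζ ^ p - 1) + π ^ (p * (p - 1))) -
      (π ^ (p * (p - 1)) - (ζ ^ p - 1) ^ (p - 1))‖ ≤ ‖(p : L)‖ ^ 2 := by
    refine le_of_eq_of_le ?_ (norm_pow_add_truncLog_le hη)
    congr 1
    ring
  -- The exponent is `p (p - 1) + 1 + p (p - 2) = (2p - 1) (p - 1)`.
  have h5 : ‖π ^ (p * (p - 1)) - (ζ ^ p - 1) ^ (p - 1)‖ = ‖π‖ ^ ((2 * p - 1) * (p - 1)) := by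
    have hlt : ‖(ζ ^ p - 1) - π ^ p‖ < ‖π ^ p‖ := by
      rw [hd, norm_pow, ← hq, ← pow_succ]
      refine pow_lt_pow_right_of_lt_one₀ hr0 hr1 ?_
      have : p * 1 ≤ p * (p - 1) := Nat.mul_le_mul_left p (by omega)
      omega
    rw [norm_sub_rev, pow_mul, norm_pow_pred_prime_sub hlt, hd, ← hq, norm_pow, ← pow_mul,
      ← pow_succ, ← pow_add]
    congr 1
    obtain ⟨n, rfl⟩ : ∃ n, p = n + 3 := ⟨p - 3, by omega⟩
    have e1 : n + 3 - 1 = n + 2 := by omega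
    have e2 : n + 3 - 2 = n + 1 := by omega
    have e3 : 2 * (n + 3) - 1 = 2 * n + 5 := by omega
    rw [e1, e2, e3]
    ring
  rw [← norm_pow, ← h5]
  refine norm_eq_of_norm_sub_lt (lt_of_le_of_lt (norm_sub_le_of_norm_sub_le h1
    (norm_sub_le_of_norm_sub_le h2 (norm_sub_le_of_norm_sub_le h3 h4))) ?_)
  rw [h5, ← hq, ← pow_mul]
  refine pow_lt_pow_right_of_lt_one₀ hr0 hr1 ?_
  calc p * (p - 1) * 2 = 2 * p * (p - 1) := by ring
    _ > (2 * p - 1) * (p - 1) := Nat.mul_lt_mul_of_pos_right (by omega) (by omega)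

end Norms

/-! ### Absolute value of the uniformizer; integrality through the norm -/

variable {p : ℕ} [Fact p.Prime]

theorem unif_eq {ζ α : PadicAlgCl p} :
    unif ζ α = (ζ - 1) ^ (-2 * (p : ℤ) + 3) *
      (α * truncLog p (ζ - 1) + (ζ - 1) ^ (p - 1)) := by
  have h : truncLog p (ζ - 1) = 1 + ∑ t ∈ Finset.Icc 1 (p - 2),
      (-1 : PadicAlgCl p) ^ t / ((t : PadicAlgCl p) + 1) * (ζ - 1) ^ t := by
    have hp2 := (Fact.out : p.Prime).two_le
    have : Finset.range (p - 1) = insert 0 (Finset.Icc 1 (p - 2)) := by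
      ext t
      simp only [Finset.mem_range, Finset.mem_insert, Finset.mem_Icc]
      omega
    rw [truncLog, this, Finset.sum_insert (by simp)]
    simp
  rw [unif, h, mul_add α, mul_one, Finset.mul_sum, add_right_comm]
  congr 3
  exact Finset.sum_congr rfl fun t _ => by ring

theorem norm_unif_pow_prime (hp : Odd p) {ζ α : PadicAlgCl p} (hζ : IsPrimitiveRoot ζ (p ^ 2))
    (hα : α ^ p = p) : ‖unif ζ α‖ ^ p = ‖ζ - 1‖ := by
  have hpp := (Fact.out : p.Prime)
  have h0 : ‖ζ - 1‖ ≠ 0 := norm_ne_zero_iff.2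
    (sub_ne_zero.2 (hζ.ne_one (Nat.one_lt_pow two_ne_zero hpp.one_lt)))
  rw [unif_eq, norm_mul, mul_pow, norm_numerator_pow hp hζ hα, norm_zpow, ← zpow_natCast,
    ← zpow_natCast, ← zpow_mul, ← zpow_add₀ h0]
  nth_rewrite 2 [← zpow_one ‖ζ - 1‖]
  congr 1
  obtain ⟨n, rfl⟩ : ∃ n, p = n + 1 := ⟨p - 1, by have := hpp.pos; omega⟩
  have e1 : 2 * (n + 1) - 1 = 2 * n + 1 := by omega
  rw [e1, Nat.add_sub_cancel]
  push_cast
  ring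

theorem norm_unif_pow (hp : Odd p) {ζ α : PadicAlgCl p} (hζ : IsPrimitiveRoot ζ (p ^ 2))
    (hα : α ^ p = p) : ‖unif ζ α‖ ^ (p ^ 2 * (p - 1)) = (p : ℝ)⁻¹ := by
  rw [sq, mul_assoc, pow_mul, norm_unif_pow_prime hp hζ hα,
    norm_sub_one_pow_eq_norm_prime hp hζ, norm_prime]

theorem pos_and_lt_one_of_norm_pow {s : ℝ} (hs : 0 ≤ s) {N : ℕ} (hN : N ≠ 0)
    (h : s ^ N = (p : ℝ)⁻¹) : 0 < s ∧ s < 1 := by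
  have hp := (Fact.out : p.Prime)
  constructor
  · refine lt_of_le_of_ne hs fun h0 => ?_
    rw [← h0, zero_pow hN] at h
    exact (inv_pos.2 (Nat.cast_pos.2 hp.pos)).ne h
  · by_contra! h1
    have := one_le_pow₀ h1 (n := N)
    rw [h] at this
    exact this.not_gt (inv_lt_one_of_one_lt₀ (Nat.one_lt_cast.2 hp.one_lt))

/-- The terms of a polynomial expression of degree less than `N` in `w` have distinct absolute
values when `‖w‖ ^ N = ‖p‖`. -/
theorem exists_norm_sum_eq_zpow {w : PadicAlgCl p} {N : ℕ} (hN : N ≠ 0)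
    (hw : ‖w‖ ^ N = (p : ℝ)⁻¹) {a : Fin N → ℚ_[p]} (ha : a ≠ 0) :
    ∃ n : ℤ, ‖∑ i, a i • w ^ (i : ℕ)‖ = ‖w‖ ^ n := by
  classical
  obtain ⟨hs0, hs1⟩ := pos_and_lt_one_of_norm_pow (norm_nonneg w) hN hw
  have hterm : ∀ i, a i ≠ 0 →
      ‖a i • w ^ (i : ℕ)‖ = ‖w‖ ^ ((N : ℤ) * (a i).valuation + i) := by
    intro i hi
    rw [norm_smul, norm_pow, Padic.norm_eq_zpow_neg_valuation hi, zpow_add₀ hs0.ne', zpow_mul,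
      zpow_natCast, zpow_natCast, hw, inv_zpow']
  set S := Finset.univ.filter fun i => a i ≠ 0 with hS
  have hSne : S.Nonempty := by
    obtain ⟨i, hi⟩ := Function.ne_iff.1 ha
    exact ⟨i, by simpa [hS] using hi⟩
  have hsum : ∑ i, a i • w ^ (i : ℕ) = ∑ i ∈ S, a i • w ^ (i : ℕ) := by
    rw [hS, Finset.sum_filter]
    refine Finset.sum_congr rfl fun i _ => ?_
    split_ifs with h
    · rfl
    · rw [not_not.1 h, zero_smul]
  rw [hsum, IsUltrametricDist.norm_sum_eq_sup'_of_pairwise_ne hSne]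
  · obtain ⟨i, hi, h⟩ := Finset.exists_mem_eq_sup' hSne fun i => ‖a i • w ^ (i : ℕ)‖
    exact ⟨_, h.trans (hterm i (by simpa [hS] using hi))⟩
  · intro i hi j hj hij h
    rw [hterm i (by simpa [hS] using hi), hterm j (by simpa [hS] using hj)] at h
    have h2 := zpow_right_injective₀ hs0 hs1.ne h
    refine hij (Fin.ext ?_)
    -- Reducing the exponents modulo `N` recovers the indices.
    have h3 := congrArg (· % (N : ℤ)) h2
    simp only [Int.mul_add_emod_self_left] at h3
    rw [← Nat.mod_eq_of_lt i.2, ← Nat.mod_eq_of_lt j.2]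
    exact_mod_cast h3

/-- The norm is the spectral norm, so `‖x‖ ≤ 1` means that the minimal polynomial over `ℚ_[p]` has
coefficients in `ℤ_[p]`; as `ℤ_[p]` is integrally closed, this is integrality. -/
theorem isIntegral_iff_norm_le_one (x : PadicAlgCl p) : IsIntegral ℤ_[p] x ↔ ‖x‖ ≤ 1 := by
  have hx : IsIntegral ℚ_[p] x := Algebra.IsIntegral.isIntegral x
  rw [← PadicAlgCl.spectralNorm_eq, spectralNorm, spectralValue_le_one_iff (minpoly.monic hx)]
  constructor
  · intro h n
    rw [minpoly.isIntegrallyClosed_eq_field_fractions' ℚ_[p] h, Polynomial.coeff_map]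
    exact ((minpoly ℤ_[p] x).coeff n).2
  · intro h
    have hl : minpoly ℚ_[p] x ∈ Polynomial.lifts (algebraMap ℤ_[p] ℚ_[p]) := by
      rw [Polynomial.lifts_iff_coeff_lifts]
      exact fun n => ⟨⟨_, h n⟩, rfl⟩
    obtain ⟨q, hq, -, hqm⟩ := Polynomial.lifts_and_natDegree_eq_and_monic hl (minpoly.monic hx)
    refine ⟨q, hqm, ?_⟩
    rw [IsScalarTower.algebraMap_eq ℤ_[p] ℚ_[p] (PadicAlgCl p), ← Polynomial.eval₂_map, hq]
    exact minpoly.aeval ℚ_[p] x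

theorem mem_integers_iff {K : IntermediateField ℚ_[p] (PadicAlgCl p)} (x : K) :
    x ∈ integers K ↔ ‖(x : PadicAlgCl p)‖ ≤ 1 := by
  rw [← isIntegral_iff_norm_le_one, mem_integralClosure_iff]
  exact (isIntegral_algHom_iff (K.val.restrictScalars ℤ_[p]) Subtype.val_injective).symm

theorem isUnit_integers_iff {K : IntermediateField ℚ_[p] (PadicAlgCl p)} (x : integers K) :
    IsUnit x ↔ ‖((x : K) : PadicAlgCl p)‖ = 1 := by
  constructor
  · rintro hx
    obtain ⟨y, hy⟩ := hx.exists_right_inv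
    have hK : (x : K) * (y : K) = 1 := congrArg Subtype.val hy
    have hL : ((x : K) : PadicAlgCl p) * ((y : K) : PadicAlgCl p) = 1 := congrArg Subtype.val hK
    have h : ‖((x : K) : PadicAlgCl p)‖ * ‖((y : K) : PadicAlgCl p)‖ = 1 := by
      rw [← norm_mul, hL, norm_one]
    have hx1 := (mem_integers_iff _).1 x.2
    have hy1 := (mem_integers_iff _).1 y.2
    have h0 := norm_nonneg ((x : K) : PadicAlgCl p)
    nlinarith
  · intro h
    have hx0 : (x : K) ≠ 0 := fun h0 => by simp [h0] at h
    have hinv : (x : K)⁻¹ ∈ integers K := by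
      rw [mem_integers_iff]
      push_cast
      rw [norm_inv, h, inv_one]
    exact IsUnit.of_mul_eq_one ⟨_, hinv⟩ (Subtype.ext (mul_inv_cancel₀ hx0))

theorem associated_of_norm_eq {K : IntermediateField ℚ_[p] (PadicAlgCl p)} {x y : integers K}
    (h : ‖((x : K) : PadicAlgCl p)‖ = ‖((y : K) : PadicAlgCl p)‖) : Associated x y := by
  rcases eq_or_ne x 0 with rfl | hx
  · have hy : y = 0 := by simpa using h.symm
    rw [hy]
  have hx0 : (x : K) ≠ 0 := by simpa using hx
  have hxn : ‖((x : K) : PadicAlgCl p)‖ ≠ 0 := by simpa using hx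
  have hd : ‖(((y : K) / (x : K) : K) : PadicAlgCl p)‖ = 1 := by
    push_cast
    rw [norm_div, h, div_self (h ▸ hxn)]
  let u : integers K := ⟨(y : K) / (x : K), (mem_integers_iff _).2 hd.le⟩
  have hu : IsUnit u := (isUnit_integers_iff u).2 hd
  exact ⟨hu.unit, Subtype.ext (mul_div_cancel₀ (y : K) hx0)⟩

/-! ### Extensions containing an element `w` with `‖w‖ ^ N = ‖p‖` -/

section EisensteinExtension

variable {K : IntermediateField ℚ_[p] (PadicAlgCl p)} {w : PadicAlgCl p} {N : ℕ}

/-- A nontrivial combination has absolute value a power of `‖w‖`, hence is nonzero. -/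
theorem linearIndependent_pow (hwK : w ∈ K) (hN : N ≠ 0) (hw : ‖w‖ ^ N = (p : ℝ)⁻¹) :
    LinearIndependent ℚ_[p] fun i : Fin N => (⟨w, hwK⟩ : K) ^ (i : ℕ) := by
  rw [Fintype.linearIndependent_iff]
  intro a h
  by_contra! hne
  obtain ⟨n, hn⟩ := exists_norm_sum_eq_zpow hN hw (a := a) (Function.ne_iff.2 hne)
  have h' := congrArg (fun z : K => ‖(z : PadicAlgCl p)‖) h
  simp only [AddSubmonoidClass.coe_finsetSum, IntermediateField.coe_smul,
    IntermediateField.coe_pow, ZeroMemClass.coe_zero, norm_zero] at h'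
  rw [h'] at hn
  exact (zpow_pos (pos_and_lt_one_of_norm_pow (norm_nonneg w) hN hw).1 n).ne hn

variable [FiniteDimensional ℚ_[p] K]

theorem finrank_eq_of_le (hwK : w ∈ K) (hN : N ≠ 0) (hw : ‖w‖ ^ N = (p : ℝ)⁻¹)
    (hK : Module.finrank ℚ_[p] K ≤ N) : Module.finrank ℚ_[p] K = N := by
  refine hK.antisymm ?_
  simpa using (linearIndependent_pow hwK hN hw).fintype_card_le_finrank

theorem exists_norm_eq_zpow (hwK : w ∈ K) (hN : N ≠ 0) (hw : ‖w‖ ^ N = (p : ℝ)⁻¹)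
    (hK : Module.finrank ℚ_[p] K ≤ N) {x : K} (hx : x ≠ 0) :
    ∃ n : ℤ, ‖(x : PadicAlgCl p)‖ = ‖w‖ ^ n := by
  have : Nonempty (Fin N) := ⟨⟨0, Nat.pos_of_ne_zero hN⟩⟩
  have hspan := (linearIndependent_pow hwK hN hw).span_eq_top_of_card_eq_finrank
    (by rw [finrank_eq_of_le hwK hN hw hK, Fintype.card_fin])
  obtain ⟨a, ha⟩ := (Submodule.mem_span_range_iff_exists_fun ℚ_[p]).1
    (hspan ▸ Submodule.mem_top : x ∈ _)
  have ha0 : a ≠ 0 := by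
    rintro rfl
    exact hx (by simpa using ha.symm)
  obtain ⟨n, hn⟩ := exists_norm_sum_eq_zpow hN hw ha0
  refine ⟨n, ?_⟩
  rw [← hn, ← ha]
  simp

theorem exists_norm_eq_pow (hwK : w ∈ K) (hN : N ≠ 0) (hw : ‖w‖ ^ N = (p : ℝ)⁻¹)
    (hK : Module.finrank ℚ_[p] K ≤ N) {x : integers K} (hx : x ≠ 0) :
    ∃ n : ℕ, ‖((x : K) : PadicAlgCl p)‖ = ‖w‖ ^ n := by
  obtain ⟨hs0, hs1⟩ := pos_and_lt_one_of_norm_pow (norm_nonneg w) hN hw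
  obtain ⟨n, hn⟩ := exists_norm_eq_zpow hwK hN hw hK (x := (x : K)) (by simpa using hx)
  have h0 : 0 ≤ n := by
    by_contra! hneg
    have := one_lt_zpow_of_neg₀ hs0 hs1 hneg
    rw [← hn] at this
    exact this.not_ge ((mem_integers_iff _).1 x.2)
  lift n to ℕ using h0
  exact ⟨n, by rw [hn, zpow_natCast]⟩

theorem irreducible_of_norm_pow (hwK : w ∈ K) (hN : N ≠ 0) (hw : ‖w‖ ^ N = (p : ℝ)⁻¹)
    (hK : Module.finrank ℚ_[p] K ≤ N) {ϖ : integers K} (hϖ : ((ϖ : K) : PadicAlgCl p) = w) :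
    Irreducible ϖ := by
  obtain ⟨hs0, hs1⟩ := pos_and_lt_one_of_norm_pow (norm_nonneg w) hN hw
  have hϖ0 : ϖ ≠ 0 := by
    rintro rfl
    simp [← hϖ] at hs0
  refine ⟨fun h => ?_, fun a b hab => ?_⟩
  · rw [isUnit_integers_iff, hϖ] at h
    exact hs1.ne h
  · obtain ⟨m, hm⟩ := exists_norm_eq_pow hwK hN hw hK (x := a)
      (fun h => hϖ0 (by rw [hab, h, zero_mul]))
    obtain ⟨n, hn⟩ := exists_norm_eq_pow hwK hN hw hK (x := b)
      (fun h => hϖ0 (by rw [hab, h, mul_zero]))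
    have h : ‖w‖ ^ 1 = ‖w‖ ^ (m + n) := by
      rw [pow_add, ← hm, ← hn, ← norm_mul, pow_one, ← hϖ, hab]
      rfl
    have h1 := pow_right_injective₀ hs0 hs1.ne h
    rw [isUnit_integers_iff, isUnit_integers_iff, hm, hn]
    rcases Nat.eq_zero_or_pos m with rfl | hmpos
    · exact Or.inl (pow_zero _)
    · have : n = 0 := by omega
      rw [this]
      exact Or.inr (pow_zero _)

theorem isUniformizer_of_norm_pow (hwK : w ∈ K) (hN : N ≠ 0) (hw : ‖w‖ ^ N = (p : ℝ)⁻¹)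
    (hK : Module.finrank ℚ_[p] K ≤ N) : IsUniformizer K w := by
  obtain ⟨hs0, hs1⟩ := pos_and_lt_one_of_norm_pow (norm_nonneg w) hN hw
  let ϖ : integers K := ⟨⟨w, hwK⟩, (mem_integers_iff _).2 hs1.le⟩
  have hirr : Irreducible ϖ := irreducible_of_norm_pow hwK hN hw hK rfl
  have hdvr : IsDiscreteValuationRing (integers K) :=
    IsDiscreteValuationRing.ofHasUnitMulPowIrreducibleFactorization ⟨ϖ, hirr, fun {x} hx => by
      obtain ⟨n, hn⟩ := exists_norm_eq_pow hwK hN hw hK hx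
      refine ⟨n, associated_of_norm_eq ?_⟩
      rw [hn, ← norm_pow]
      rfl⟩
  exact ⟨hdvr, ϖ, rfl, hirr.maximalIdeal_eq⟩

theorem isTotallyRamified_of_norm_pow (hwK : w ∈ K) (hN : N ≠ 0) (hw : ‖w‖ ^ N = (p : ℝ)⁻¹)
    (hK : Module.finrank ℚ_[p] K ≤ N) : IsTotallyRamified K := by
  refine ⟨inferInstance, fun P hP => ?_⟩
  obtain ⟨hdvr, ϖ, hϖ, hmax⟩ := isUniformizer_of_norm_pow hwK hN hw hK
  have hirr : Irreducible ϖ := irreducible_of_norm_pow hwK hN hw hK hϖ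
  rw [finrank_eq_of_le hwK hN hw hK]
  have hPϖ : P = Ideal.span {ϖ} := by rw [← hmax, IsLocalRing.eq_maximalIdeal hP]
  have hunder : P.under ℤ_[p] = Ideal.span {(p : ℤ_[p])} := by
    have : (P.under ℤ_[p]).IsMaximal := Ideal.isMaximal_comap_of_isIntegral_of_isMaximal P
    rw [IsLocalRing.eq_maximalIdeal this, PadicInt.maximalIdeal_eq_span_p]
  -- `p` and `ϖ ^ N` have equal absolute values, so they differ by a unit.
  have hmap : (P.under ℤ_[p]).map (algebraMap ℤ_[p] (integers K)) = Ideal.span {ϖ ^ N} := by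
    rw [hunder, Ideal.map_span, Set.image_singleton, map_natCast,
      Ideal.span_singleton_eq_span_singleton]
    refine associated_of_norm_eq ?_
    have h1 : (((p : integers K) : K) : PadicAlgCl p) = p := rfl
    have h2 : (((ϖ ^ N : integers K) : K) : PadicAlgCl p) = w ^ N := by rw [← hϖ]; rfl
    rw [h1, h2, norm_pow, hw, norm_prime]
  rw [← Ideal.ramificationIdx'_eq_ramificationIdx' (P.under ℤ_[p]) P]
  · refine Ideal.ramificationIdx'_spec ?_ ?_
    · rw [hmap, hPϖ, Ideal.span_singleton_pow]
    · rw [hmap, hPϖ, Ideal.span_singleton_pow, Ideal.span_singleton_le_span_singleton,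
        pow_dvd_pow_iff hirr.ne_zero hirr.not_isUnit]
      omega
  · rw [hmap, Ne, Ideal.span_singleton_eq_bot]
    exact pow_ne_zero N hirr.ne_zero

end EisensteinExtension

/-! ### Degree bound and conclusion -/

theorem finrank_adjoin_simple_le {F E : Type*} [Field F] [Field E] [Algebra F E]
    {x : E} {f : Polynomial F} (hf : f.Monic) (hx : Polynomial.aeval x f = 0) :
    Module.finrank F F⟮x⟯ ≤ f.natDegree := by
  rw [IntermediateField.adjoin.finrank ⟨f, hf, hx⟩]
  exact Polynomial.natDegree_le_of_dvd (minpoly.dvd F x hx) hf.ne_zero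

/-- An upper bound suffices, so neither irreducibility nor linear disjointness is needed; the
independent powers of `w` give the reverse inequality. -/
theorem finrank_adjoin_root_of_unity_and_radical_le {ζ α : PadicAlgCl p}
    (hζ : IsPrimitiveRoot ζ (p ^ 2)) (hα : α ^ p = p) :
    Module.finrank ℚ_[p] ℚ_[p]⟮ζ, α⟯ ≤ p ^ 2 * (p - 1) := by
  have hp := (Fact.out : p.Prime)
  have h1 : Module.finrank ℚ_[p] ℚ_[p]⟮ζ⟯ ≤ p * (p - 1) := by
    have h := finrank_adjoin_simple_le (x := ζ) (Polynomial.cyclotomic.monic (p ^ 2) ℚ_[p]) (by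
      rw [Polynomial.aeval_def, ← Polynomial.eval_map, Polynomial.map_cyclotomic]
      exact hζ.isRoot_cyclotomic (pow_pos hp.pos 2))
    rwa [Polynomial.natDegree_cyclotomic, Nat.totient_prime_pow hp two_pos, show 2 - 1 = 1 from rfl, pow_one] at h
  have h2 : Module.finrank ℚ_[p] ℚ_[p]⟮α⟯ ≤ p := by
    have h := finrank_adjoin_simple_le (x := α)
      (Polynomial.monic_X_pow_sub_C (p : ℚ_[p]) hp.ne_zero) (by simp [hα])
    rwa [Polynomial.natDegree_X_pow_sub_C] at h
  have h3 : ℚ_[p]⟮ζ, α⟯ = ℚ_[p]⟮ζ⟯ ⊔ ℚ_[p]⟮α⟯ := by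
    rw [← IntermediateField.adjoin_union, Set.singleton_union]
  rw [h3]
  calc _ ≤ _ := IntermediateField.finrank_sup_le _ _
    _ ≤ p * (p - 1) * p := Nat.mul_le_mul h1 h2
    _ = p ^ 2 * (p - 1) := by ring

theorem unif_mem_adjoin (ζ α : PadicAlgCl p) : unif ζ α ∈ ℚ_[p]⟮ζ, α⟯ := by
  have hζ : ζ ∈ ℚ_[p]⟮ζ, α⟯ := IntermediateField.subset_adjoin _ _ (by simp)
  have hα : α ∈ ℚ_[p]⟮ζ, α⟯ := IntermediateField.subset_adjoin _ _ (by simp)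
  have hπ : ζ - 1 ∈ ℚ_[p]⟮ζ, α⟯ := sub_mem hζ (one_mem _)
  refine mul_mem (zpow_mem hπ _) (add_mem (add_mem hα (pow_mem hπ _)) (sum_mem fun t _ => ?_))
  exact mul_mem (mul_mem (div_mem (pow_mem (neg_mem (one_mem _)) _)
    (add_mem (natCast_mem _ t) (one_mem _))) hα) (pow_mem hπ _)

end PadicUniformizer

theorem theorem1 (p : ℕ) [Fact p.Prime] (hp : Odd p) (ζ α : PadicAlgCl p)
    (hζ : IsPrimitiveRoot ζ (p ^ 2)) (hα : α ^ p = (p : PadicAlgCl p)) :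
    PadicUniformizer.IsUniformizer ℚ_[p]⟮ζ, α⟯ (PadicUniformizer.unif ζ α) ∧
    PadicUniformizer.unif ζ α ≠ 0 ∧
    PadicUniformizer.ordP (PadicUniformizer.unif ζ α) = 1 / ((p : ℝ) ^ 2 * ((p : ℝ) - 1)) ∧
    PadicUniformizer.IsTotallyRamified ℚ_[p]⟮ζ, α⟯ ∧
    Module.finrank ℚ_[p] ℚ_[p]⟮ζ, α⟯ = p ^ 2 * (p - 1) := by
  open PadicUniformizer in
  have hpp := (Fact.out : p.Prime)
  have hN : p ^ 2 * (p - 1) ≠ 0 :=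
    mul_ne_zero (pow_ne_zero 2 hpp.ne_zero) (Nat.sub_ne_zero_of_lt hpp.one_lt)
  have hw := norm_unif_pow hp hζ hα
  have hwK := unif_mem_adjoin ζ α
  have hK := finrank_adjoin_root_of_unity_and_radical_le hζ hα
  have : FiniteDimensional ℚ_[p] ℚ_[p]⟮ζ, α⟯ :=
    IntermediateField.finiteDimensional_adjoin fun x _ => Algebra.IsIntegral.isIntegral x
  have hs0 := (pos_and_lt_one_of_norm_pow (norm_nonneg _) hN hw).1
  refine ⟨isUniformizer_of_norm_pow hwK hN hw hK, norm_pos_iff.1 hs0, ?_,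
    isTotallyRamified_of_norm_pow hwK hN hw hK, finrank_eq_of_le hwK hN hw hK⟩
  have hp1 : (1 : ℝ) < p := Nat.one_lt_cast.2 hpp.one_lt
  have h := congrArg (Real.logb p) hw
  rw [Real.logb_pow, Real.logb_inv, Real.logb_self_eq_one hp1] at h
  push_cast [Nat.cast_sub hpp.one_le] at h
  have h0 : (p : ℝ) ^ 2 * ((p : ℝ) - 1) ≠ 0 :=
    mul_ne_zero (pow_ne_zero 2 (by linarith)) (by linarith)
  rw [ordP, eq_div_iff h0]
  linarith
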